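/- Let $p,q\in[0,1]$, $R_f\ge 0$ and $0\le C_0<C_1$. The states $S_1,\dots,S_N$ of $N$ sub-channels are i.i.d. Bernoulli$(q)$; sub-channel $i$ is good, with capacity $C_1$, if $S_i=1$, and bad, with capacity $C_0$, if $S_i=0$. A feedback code for $N$ sub-channels maps the state vector $S=(S_1,\dots,S_N)$ to one of $M\le 2^{NR_f}$ messages (a feedback rate of at most $R_f$ bits per sub-channel per coherence block), and maps every message to a power loading vector $\hat s\in\{0,1\}^N$ with $\frac1N\sum_{i=1}^N\hat s_i\le p$; sub-channel $i$ is activated if and only if $\hat s_i=1$. If $\hat S$ denotes the resulting power loading vector, the forward data rate per sub-channel of the code is $\frac1N\,\mathbb E\sum_{i=1}^N \hat S_i C_{S_i}$. A number $r$ is achievable if for every $\delta>0$ and all sufficiently large $N$ there is such a code with forward data rate per sub-channel at least $r-\delta$. Let $H_2(x)=-x\log_2 x-(1-x)\log_2(1-x)$. Then the optimization problem $$\text{minimize }\varepsilon_0\quad\text{subject to}\quad H_2(p)-qH_2(\varepsilon_0)-(1-q)H_2(\varepsilon_1)\le R_f,\quad q(1-\varepsilon_0)+(1-q)\varepsilon_1=p,\quad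 0\le\varepsilon_0,\varepsilon_1\le 1$$ has an optimal value $\varepsilon_0^*$, which is attained, and the maximum achievable forward data rate per sub-channel is $$C=q(1-\varepsilon_0^*)(C_1-C_0)+pC_0 .$$ That is, $C$ is the largest achievable number; moreover, for every $N$ the maximum of the forward data rate per sub-channel over all such codes exists, and it converges to $C$ as $N\to\infty$. -/

import Mathlib

open Filter Topology

noncomputable section

/-- The binary entropy function, in bits. -/
def H2 (x : ℝ) : ℝ := Real.binEntropy x / Real.log 2

/-- Probability of the state vector `s` of `N` independent sub-channels, each of which is
good (`true`) with probability `q` and bad (`false`) with probability `1 - q`. -/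
def stateProb (q : ℝ) {N : ℕ} (s : Fin N → Bool) : ℝ :=
  ∏ i, if s i = true then q else 1 - q

/-- A feedback code for `N` sub-channels with `M` feedback messages. The receiver maps the
channel state vector to a message; the transmitter maps the message to a power loading vector
(`true` means that the sub-channel is activated). -/
structure FeedbackCode (N M : ℕ) where
  /-- The map used by the receiver. -/
  encode : (Fin N → Bool) → Fin M
  /-- The map used by the transmitter. -/
  decode : Fin M → (Fin N → Bool)

/-- The normalized weight of a power loading vector: the fraction of activated sub-channels. -/
def normWeight {N : ℕ} (v : Fin N → Bool) : ℝ :=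
  (1 / (N : ℝ)) * ∑ i, if v i = true then (1 : ℝ) else 0

/-- Data rate per sub-channel when the states are `s` and the power loading vector is `v`:
an activated sub-channel contributes its capacity, which is `C1` if it is good and `C0` if it
is bad; a sub-channel that is not activated contributes nothing. -/
def dataRate (C0 C1 : ℝ) {N : ℕ} (s v : Fin N → Bool) : ℝ :=
  (1 / (N : ℝ)) * ∑ i, if v i = true then (if s i = true then C1 else C0) else 0

namespace FeedbackCode

/-- The code uses at most `N * Rf` feedback bits per coherence block, and each of its power
loading vectors activates at most a fraction `p` of the sub-channels. -/
def Admissible {N M : ℕ} (c : FeedbackCode N M) (p Rf : ℝ) : Prop :=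
  (M : ℝ) ≤ (2 : ℝ) ^ ((N : ℝ) * Rf) ∧ ∀ m : Fin M, normWeight (c.decode m) ≤ p

/-- Expected forward data rate per sub-channel achieved by the code. -/
def forwardRate {N M : ℕ} (c : FeedbackCode N M) (q C0 C1 : ℝ) : ℝ :=
  ∑ s : Fin N → Bool, stateProb q s * dataRate C0 C1 s (c.decode (c.encode s))

end FeedbackCode

/-- The forward data rates per sub-channel of all admissible codes for `N` sub-channels. -/
def forwardRates (p q Rf C0 C1 : ℝ) (N : ℕ) : Set ℝ :=
  {r | ∃ (M : ℕ) (c : FeedbackCode N M), c.Admissible p Rf ∧ c.forwardRate q C0 C1 = r}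

/-- `r` is asymptotically achievable: up to an arbitrarily small loss, it is attained by
admissible codes for all sufficiently large numbers of sub-channels. -/
def Achievable (p q Rf C0 C1 r : ℝ) : Prop :=
  ∀ δ : ℝ, 0 < δ → ∀ᶠ N : ℕ in atTop, ∃ r' ∈ forwardRates p q Rf C0 C1 N, r - δ ≤ r'

/-- The constraints of the optimization problem over the crossover probabilities. -/
def Feasible (p q Rf ε0 ε1 : ℝ) : Prop :=
  H2 p - q * H2 ε0 - (1 - q) * H2 ε1 ≤ Rf ∧
  q * (1 - ε0) + (1 - q) * ε1 = p ∧
  0 ≤ ε0 ∧ ε0 ≤ 1 ∧ 0 ≤ ε1 ∧ ε1 ≤ 1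

end

/-!
The problem is a rate-distortion problem: the feedback describes the state vector, and its
quality is measured by the data rate of the activated sub-channels. A test channel activates a
sub-channel in state `a` with probability `W a`; in terms of the crossover probabilities,
`W true = 1 - ε0` and `W false = ε1`. The first constraint bounds the mutual information between
state and activation by `Rf`, and the second fixes the activation probability to `p`.

Converse (`forwardRate_le`, valid for every `N`). For a test function `g` with
`∑ a, P a * g a b ≤ 1` for both `b`, the product of the values of `g` along a code has mean at
most `M`, so Jensen's inequality bounds the mean of `log g` under the averaged joint law of state
and activation by `Rf * log 2` (`sum_jointLaw_mul_log_le`). This replaces the chain rule, the data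
processing inequality and the convexity of mutual information. If the code activates less than a
fraction `p` on average, its law is mixed with "activate everything"; the likelihood ratio of the
mixture, taken as `g`, shows that the mixture is feasible, and it activates good sub-channels at
least as often.

Achievability. For `0 < p < 1` and `0 < Rf` an optimal test channel is perturbed so that both the
information and the power constraint become strict (`achievable_of_feasible`). By Chernoff's bound
(`exists_pow_bound_of_mean_neg`) a state vector and its random response are typical up to an
exponentially small probability, and for most states the typical responses together have
probability at least `exp (-(N * J)) / 2` under independent Bernoulli components with parameter
`p`, for some `J < Rf * log 2`. Hence greedily chosen codewords cover almost all
states (`exists_codebook`, `exists_covering_code`). If `p` is `0` or `1` or `Rf = 0`, state and activation of a feasible test channel are no better correlated than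
independent ones (`mul_one_sub_le_of_degenerate`), and one fixed codeword suffices
(`achievable_const`).

For fixed `N` there are only finitely many rates, so the maximum exists; it is squeezed between
the converse bound and the achievability bound.
-/

/-! ### Product weights -/

/-- The weight function on `Bool` giving mass `x` to `true` and `1 - x` to `false`. -/
noncomputable def bern (x : ℝ) (b : Bool) : ℝ := if b = true then x else 1 - x

lemma bern_nonneg {x : ℝ} (h0 : 0 ≤ x) (h1 : x ≤ 1) (b : Bool) : 0 ≤ bern x b := by
  cases b <;> simp [bern, h0, h1]

lemma sum_bern (x : ℝ) : ∑ b, bern x b = 1 := by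
  simp [bern]

lemma stateProb_eq_prod_bern (q : ℝ) {N : ℕ} (s : Fin N → Bool) :
    stateProb q s = ∏ i, bern q (s i) := rfl

lemma stateProb_nonneg {q : ℝ} (h0 : 0 ≤ q) (h1 : q ≤ 1) {N : ℕ} (s : Fin N → Bool) :
    0 ≤ stateProb q s :=
  Finset.prod_nonneg fun i _ => bern_nonneg h0 h1 (s i)

lemma sum_stateProb (q : ℝ) (N : ℕ) : ∑ s : Fin N → Bool, stateProb q s = 1 := by
  simp only [stateProb_eq_prod_bern]
  rw [← Fintype.prod_sum (fun (_ : Fin N) b => bern q b)]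
  simp only [sum_bern, Finset.prod_const_one]

lemma sum_stateProb_mul_apply (q : ℝ) {N : ℕ} (i : Fin N) (f : Bool → ℝ) :
    ∑ s : Fin N → Bool, stateProb q s * f (s i) = ∑ a, bern q a * f a := by
  have h : ∀ s : Fin N → Bool, stateProb q s * f (s i)
      = ∏ j, bern q (s j) * (if j = i then f (s j) else 1) := by
    intro s
    rw [Finset.prod_mul_distrib, Finset.prod_ite_eq' Finset.univ i (fun j => f (s j))]
    simp [stateProb_eq_prod_bern]
  simp_rw [h]
  rw [← Fintype.prod_sum (fun j b => bern q b * (if j = i then f b else 1))]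
  rw [Finset.prod_eq_single i]
  · simp
  · intro j _ hj
    simp only [hj, if_false, mul_one, sum_bern]
  · simp

/-! ### An exponential bound for sums of independent variables -/

/-- Chernoff's bound: if `h` has negative mean under the weights `w`, then the probability
that a sum of `N` independent copies of `h` is nonnegative decays exponentially in `N`. -/
lemma exists_pow_bound_of_mean_neg {X : Type*} [Fintype X] (w h : X → ℝ) (hw : ∀ x, 0 ≤ w x)
    (hw1 : ∑ x, w x = 1) (hh : ∑ x, w x * h x < 0) :
    ∃ ρ : ℝ, 0 ≤ ρ ∧ ρ < 1 ∧ ∀ N : ℕ,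
      ∑ x : Fin N → X, (if 0 ≤ ∑ i, h (x i) then ∏ i, w (x i) else 0) ≤ ρ ^ N := by
  -- The moment generating function has value `1` and negative derivative at `0`.
  have hd : HasDerivAt (fun l : ℝ => ∑ x, w x * Real.exp (l * h x)) (∑ x, w x * h x) 0 := by
    apply HasDerivAt.fun_sum
    intro x _
    have := (((hasDerivAt_id (0 : ℝ)).mul_const (h x)).exp).const_mul (w x)
    simpa using this
  have hev := (hd.tendsto_slope_zero_right).eventually (gt_mem_nhds hh)
  obtain ⟨l, hl, hl0⟩ := (hev.and self_mem_nhdsWithin).exists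
  replace hl0 : 0 < l := hl0
  refine ⟨∑ x, w x * Real.exp (l * h x),
    Finset.sum_nonneg fun x _ => mul_nonneg (hw x) (Real.exp_pos _).le, ?_, ?_⟩
  · simp only [zero_add, zero_mul, Real.exp_zero, mul_one, hw1, smul_eq_mul] at hl
    have := (inv_pos.2 hl0)
    by_contra hcon
    push Not at hcon
    exact absurd hl (not_lt.2 (mul_nonneg this.le (by linarith)))
  · intro N
    calc _ ≤ ∑ x : Fin N → X, ∏ i, (w (x i) * Real.exp (l * h (x i))) := by
          apply Finset.sum_le_sum
          intro x _
          rw [Finset.prod_mul_distrib, ← Real.exp_sum, ← Finset.mul_sum]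
          have hp : 0 ≤ ∏ i, w (x i) := Finset.prod_nonneg fun i _ => hw _
          split_ifs with hx
          · exact le_mul_of_one_le_right hp (Real.one_le_exp (mul_nonneg hl0.le hx))
          · exact mul_nonneg hp (Real.exp_pos _).le
      _ = _ := by
          rw [← Fintype.prod_sum (fun (_ : Fin N) x => w x * Real.exp (l * h x))]
          simp

/-- The form of `exists_pow_bound_of_mean_neg` for pairs, with the sum over pairs of sequences. -/
lemma exists_pow_bound_of_mean_neg_prod {X Y : Type*} [Fintype X] [Fintype Y] (w h : X → Y → ℝ)
    (hw : ∀ x y, 0 ≤ w x y) (hw1 : ∑ x, ∑ y, w x y = 1) (hh : ∑ x, ∑ y, w x y * h x y < 0) :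
    ∃ ρ : ℝ, 0 ≤ ρ ∧ ρ < 1 ∧ ∀ N : ℕ, ∑ x : Fin N → X, ∑ y : Fin N → Y,
      (if 0 ≤ ∑ i, h (x i) (y i) then ∏ i, w (x i) (y i) else 0) ≤ ρ ^ N := by
  obtain ⟨ρ, h0, h1, hρ⟩ := exists_pow_bound_of_mean_neg (fun z : X × Y => w z.1 z.2)
    (fun z => h z.1 z.2) (fun z => hw _ _) (by rw [Fintype.sum_prod_type]; exact hw1)
    (by rw [Fintype.sum_prod_type]; exact hh)
  refine ⟨ρ, h0, h1, fun N => le_trans (le_of_eq ?_) (hρ N)⟩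
  rw [← Fintype.sum_prod_type' (f := fun (x : Fin N → X) (y : Fin N → Y) =>
    if 0 ≤ ∑ i, h (x i) (y i) then ∏ i, w (x i) (y i) else 0)]
  exact (Fintype.sum_equiv (Equiv.arrowProdEquivProdArrow (Fin N) (fun _ => X) (fun _ => Y))
    _ _ fun z => rfl).symm

/-! ### Greedy covering -/

open Classical in
/-- If every point `s` of positive weight is covered by a `Q`-random `v` with probability at
least `y`, then some codebook of size `M` leaves at most the fraction `(1 - y) ^ M` uncovered.
The codewords are chosen one after the other, each covering at least the fraction `y` of what
is still uncovered. -/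
lemma exists_codebook {S V : Type*} [Fintype S] [Fintype V] (P : S → ℝ) (Q : V → ℝ)
    (hP : ∀ s, 0 ≤ P s) (hQ : ∀ v, 0 ≤ Q v) (hQ1 : ∑ v, Q v = 1) (T : S → V → Prop) (y : ℝ)
    (hy1 : y ≤ 1) (hy : ∀ s, P s ≠ 0 → y ≤ ∑ v, if T s v then Q v else 0) (M : ℕ) :
    ∃ c : Fin M → V, ∑ s, (if ∃ m, T s (c m) then 0 else P s) ≤ (1 - y) ^ M * ∑ s, P s := by
  induction M with
  | zero => exact ⟨Fin.elim0, by simp⟩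
  | succ M ih =>
    obtain ⟨c, hc⟩ := ih
    set u : S → ℝ := fun s => if ∃ m, T s (c m) then 0 else P s with hu
    have hu0 : ∀ s, 0 ≤ u s := by
      intro s
      simp only [hu]
      split_ifs
      exacts [le_rfl, hP s]
    have key : ∑ v, Q v * ∑ s, (if T s v then 0 else u s) ≤ (1 - y) * ∑ s, u s := by
      simp_rw [Finset.mul_sum]
      rw [Finset.sum_comm]
      apply Finset.sum_le_sum
      intro s _
      have e : ∑ v, Q v * (if T s v then 0 else u s)
          = u s * (1 - ∑ v, if T s v then Q v else 0) := by
        rw [← hQ1, ← Finset.sum_sub_distrib, Finset.mul_sum]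
        apply Finset.sum_congr rfl
        intro v _
        split_ifs <;> ring
      rw [e, mul_comm (1 - y)]
      by_cases h0 : P s = 0
      · have : u s = 0 := by simp [hu, h0]
        simp [this]
      · exact mul_le_mul_of_nonneg_left (by linarith [hy s h0]) (hu0 s)
    obtain ⟨v, hv⟩ : ∃ v, ∑ s, (if T s v then 0 else u s) ≤ (1 - y) * ∑ s, u s := by
      by_contra hcon
      push Not at hcon
      obtain ⟨v₀, hv₀⟩ : ∃ v, 0 < Q v := by
        by_contra h
        push Not at h
        have : ∑ v, Q v ≤ 0 := Finset.sum_nonpos fun v _ => h v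
        linarith
      have : ∑ v, Q v * ((1 - y) * ∑ s, u s) < ∑ v, Q v * ∑ s, (if T s v then 0 else u s) :=
        Finset.sum_lt_sum (fun v _ => mul_le_mul_of_nonneg_left (hcon v).le (hQ v))
          ⟨v₀, Finset.mem_univ _, mul_lt_mul_of_pos_left (hcon v₀) hv₀⟩
      rw [← Finset.sum_mul, hQ1, one_mul] at this
      linarith
    refine ⟨Fin.cons v c, ?_⟩
    calc _ = ∑ s, (if T s v then 0 else u s) := by
          apply Finset.sum_congr rfl
          intro s _
          simp only [Fin.exists_fin_succ, Fin.cons_zero, Fin.cons_succ, hu]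
          by_cases h1 : T s v <;> simp [h1]
      _ ≤ (1 - y) * ∑ s, u s := hv
      _ ≤ (1 - y) * ((1 - y) ^ M * ∑ s, P s) := mul_le_mul_of_nonneg_left hc (by linarith)
      _ = _ := by ring

/-! ### Information functional -/

/-- The divergence (in nats) of the joint law of state and activation from the product of the
state law and the Bernoulli law with parameter `p`. A state `a` has weight `bern q a` and leads
to activation with probability `W a`. If `p` is the overall activation probability, this is the
mutual information between state and activation. The formula is meaningful only if `bern p b`
vanishes for no `b` of positive probability. -/
noncomputable def info (q p : ℝ) (W : Bool → ℝ) : ℝ :=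
  ∑ a, ∑ b, bern q a * bern (W a) b * Real.log (bern (W a) b / bern p b)

lemma info_eq (q p : ℝ) (W : Bool → ℝ)
    (h : ∀ a b, bern q a * bern (W a) b ≠ 0 → bern p b ≠ 0) :
    info q p W = -(q * Real.binEntropy (W true)) - (1 - q) * Real.binEntropy (W false)
      - (q * W true + (1 - q) * W false) * Real.log p
      - (1 - (q * W true + (1 - q) * W false)) * Real.log (1 - p) := by
  have key : ∀ a b, bern q a * bern (W a) b * Real.log (bern (W a) b / bern p b)
      = bern q a * bern (W a) b * (Real.log (bern (W a) b) - Real.log (bern p b)) := by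
    intro a b
    by_cases h0 : bern q a * bern (W a) b = 0
    · rw [h0, zero_mul, zero_mul]
    · rw [Real.log_div (right_ne_zero_of_mul h0) (h a b h0)]
  simp only [info, key]
  simp [bern, Real.binEntropy, Real.log_inv]
  ring

/-! ### Converse -/

/-- The joint law of state and activation under the power loading rule `φ`, averaged over the
sub-channels. -/
noncomputable def jointLaw (q : ℝ) {N : ℕ} (φ : (Fin N → Bool) → (Fin N → Bool))
    (a b : Bool) : ℝ :=
  (1 / (N : ℝ)) * ∑ i, ∑ s, stateProb q s * (if s i = a ∧ φ s i = b then 1 else 0)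

lemma sum_jointLaw_mul (q : ℝ) {N : ℕ} (φ : (Fin N → Bool) → (Fin N → Bool))
    (f : Bool → Bool → ℝ) :
    ∑ a, ∑ b, jointLaw q φ a b * f a b
      = (1 / (N : ℝ)) * ∑ i, ∑ s, stateProb q s * f (s i) (φ s i) := by
  simp only [Fintype.sum_bool, jointLaw, Finset.mul_sum, Finset.sum_mul,
    ← Finset.sum_add_distrib]
  refine Finset.sum_congr rfl fun i _ => Finset.sum_congr rfl fun s _ => ?_
  cases s i <;> cases φ s i <;> simp <;> ring

lemma jointLaw_nonneg {q : ℝ} (h0 : 0 ≤ q) (h1 : q ≤ 1) {N : ℕ}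
    (φ : (Fin N → Bool) → (Fin N → Bool)) (a b : Bool) : 0 ≤ jointLaw q φ a b := by
  refine mul_nonneg (by positivity) (Finset.sum_nonneg fun i _ => Finset.sum_nonneg fun s _ =>
    mul_nonneg (stateProb_nonneg h0 h1 s) ?_)
  split_ifs <;> norm_num

lemma jointLaw_pos {q : ℝ} (h0 : 0 ≤ q) (h1 : q ≤ 1) {N : ℕ}
    (φ : (Fin N → Bool) → (Fin N → Bool)) {s : Fin N → Bool} (hs : 0 < stateProb q s)
    (i : Fin N) : 0 < jointLaw q φ (s i) (φ s i) := by
  have hN : 0 < N := i.pos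
  have hnn : ∀ j t, 0 ≤ stateProb q t * (if t j = s i ∧ φ t j = φ s i then (1 : ℝ) else 0) := by
    intro j t
    refine mul_nonneg (stateProb_nonneg h0 h1 t) ?_
    split_ifs <;> norm_num
  refine mul_pos (by positivity) (Finset.sum_pos' (fun j _ => Finset.sum_nonneg fun t _ => hnn j t)
    ⟨i, Finset.mem_univ _, Finset.sum_pos' (fun t _ => hnn i t) ⟨s, Finset.mem_univ _, ?_⟩⟩)
  simpa using hs

lemma sum_jointLaw_right (q : ℝ) {N : ℕ} (hN : 0 < N) (φ : (Fin N → Bool) → (Fin N → Bool))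
    (a : Bool) : ∑ b, jointLaw q φ a b = bern q a := by
  have h := sum_jointLaw_mul q φ (fun a' _ => if a' = a then 1 else 0)
  have e : ∀ i : Fin N, ∑ s, stateProb q s * (if s i = a then (1 : ℝ) else 0) = bern q a := by
    intro i
    rw [sum_stateProb_mul_apply q i (fun a' => if a' = a then (1 : ℝ) else 0)]
    simp
  simp only [e, Finset.sum_const, Finset.card_univ, Fintype.card_fin, nsmul_eq_mul] at h
  have hN' : (N : ℝ) ≠ 0 := by positivity
  rw [← mul_assoc, one_div, inv_mul_cancel₀ hN', one_mul] at h
  rw [← h]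
  cases a <;> simp

lemma jointLaw_true_add_le (q p : ℝ) (h0 : 0 ≤ q) (h1 : q ≤ 1) {N : ℕ}
    (φ : (Fin N → Bool) → (Fin N → Bool)) (hφ : ∀ s, normWeight (φ s) ≤ p) :
    jointLaw q φ true true + jointLaw q φ false true ≤ p := by
  have h := sum_jointLaw_mul q φ (fun _ b => if b = true then 1 else 0)
  have e : jointLaw q φ true true + jointLaw q φ false true
      = ∑ s, stateProb q s * normWeight (φ s) := by
    simp only [Fintype.sum_bool, if_true, Bool.false_eq_true, if_false, mul_one, mul_zero,
      add_zero] at h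
    rw [h, Finset.sum_comm, Finset.mul_sum]
    refine Finset.sum_congr rfl fun s _ => ?_
    rw [normWeight, ← Finset.mul_sum]
    ring
  rw [e]
  calc _ ≤ ∑ s : Fin N → Bool, stateProb q s * p :=
        Finset.sum_le_sum fun s _ => mul_le_mul_of_nonneg_left (hφ s) (stateProb_nonneg h0 h1 s)
    _ = p := by rw [← Finset.sum_mul, sum_stateProb, one_mul]

lemma forwardRate_eq_jointLaw {N M : ℕ} (c : FeedbackCode N M) (q C0 C1 : ℝ) :
    c.forwardRate q C0 C1 = jointLaw q (fun s => c.decode (c.encode s)) true true * C1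
      + jointLaw q (fun s => c.decode (c.encode s)) false true * C0 := by
  have h := sum_jointLaw_mul q (fun s => c.decode (c.encode s))
    (fun a b => if b = true then (if a = true then C1 else C0) else 0)
  simp only [Fintype.sum_bool, if_true, Bool.false_eq_true, if_false, mul_zero, add_zero] at h
  rw [h, Finset.sum_comm, Finset.mul_sum]
  refine Finset.sum_congr rfl fun s _ => ?_
  rw [dataRate, ← Finset.mul_sum]
  ring

/-- Every test function `g` that has mean at most `1` under the state law, for each fixed
activation, certifies a lower bound for the feedback rate. For independent states and one fixed
codeword the product of the values of `g` has mean at most `1`; for the codeword chosen by the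
encoder it is bounded by the sum over all `M` codewords, and Jensen's inequality in the form
`log x ≤ x - 1` gives the claim. -/
lemma sum_jointLaw_mul_log_le {N M : ℕ} (c : FeedbackCode N M) {p q Rf : ℝ} (h0 : 0 ≤ q)
    (h1 : q ≤ 1) (hN : 0 < N) (hc : c.Admissible p Rf) (g : Bool → Bool → ℝ)
    (hg : ∀ a b, 0 ≤ g a b) (hg1 : ∀ b, ∑ a, bern q a * g a b ≤ 1)
    (hpos : ∀ a b, 0 < jointLaw q (fun s => c.decode (c.encode s)) a b → 0 < g a b) :
    ∑ a, ∑ b, jointLaw q (fun s => c.decode (c.encode s)) a b * Real.log (g a b)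
      ≤ Rf * Real.log 2 := by
  set φ : (Fin N → Bool) → (Fin N → Bool) := fun s => c.decode (c.encode s) with hφ
  have hM : 0 < M := (c.encode fun _ => true).pos
  have hM' : (0 : ℝ) < M := by exact_mod_cast hM
  have hN' : (0 : ℝ) < N := by exact_mod_cast hN
  have step : ∀ s, stateProb q s * (∑ i, Real.log (g (s i) (φ s i)) - Real.log M)
      ≤ stateProb q s * ((∏ i, g (s i) (φ s i)) / M) - stateProb q s := by
    intro s
    rcases (stateProb_nonneg h0 h1 s).eq_or_lt with hs | hs
    · simp [← hs]
    · have hgp : ∀ i, 0 < g (s i) (φ s i) := fun i => hpos _ _ (jointLaw_pos h0 h1 φ hs i)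
      have hG : 0 < ∏ i, g (s i) (φ s i) := Finset.prod_pos fun i _ => hgp i
      rw [← Real.log_prod (fun i _ => (hgp i).ne'), ← Real.log_div hG.ne' hM'.ne']
      have := Real.log_le_sub_one_of_pos (div_pos hG hM')
      nlinarith
  have hcode : ∑ s, stateProb q s * ∏ i, g (s i) (φ s i) ≤ M := by
    calc _ ≤ ∑ s, ∑ m, stateProb q s * ∏ i, g (s i) (c.decode m i) := by
          refine Finset.sum_le_sum fun s _ => ?_
          exact Finset.single_le_sum
            (f := fun m => stateProb q s * ∏ i, g (s i) (c.decode m i))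
            (fun m _ => mul_nonneg (stateProb_nonneg h0 h1 s)
              (Finset.prod_nonneg fun i _ => hg _ _)) (Finset.mem_univ (c.encode s))
      _ = ∑ m, ∏ i, ∑ a, bern q a * g a (c.decode m i) := by
          rw [Finset.sum_comm]
          refine Finset.sum_congr rfl fun m _ => ?_
          rw [Fintype.prod_sum (fun i a => bern q a * g a (c.decode m i))]
          refine Finset.sum_congr rfl fun s _ => ?_
          rw [Finset.prod_mul_distrib, stateProb_eq_prod_bern]
      _ ≤ ∑ m : Fin M, (1 : ℝ) := by
          refine Finset.sum_le_sum fun m _ => Finset.prod_le_one (fun i _ => ?_) fun i _ => hg1 _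
          exact Finset.sum_nonneg fun a _ => mul_nonneg (bern_nonneg h0 h1 a) (hg _ _)
      _ = M := by simp
  have hsum := Finset.sum_le_sum fun s (_ : s ∈ Finset.univ) => step s
  rw [Finset.sum_sub_distrib, sum_stateProb] at hsum
  have e1 : ∑ s, stateProb q s * ((∏ i, g (s i) (φ s i)) / M) ≤ 1 := by
    have : ∑ s, stateProb q s * ((∏ i, g (s i) (φ s i)) / M)
        = (∑ s, stateProb q s * ∏ i, g (s i) (φ s i)) / M := by
      rw [Finset.sum_div]
      exact Finset.sum_congr rfl fun s _ => by ring
    rw [this]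
    exact (div_le_one hM').2 hcode
  have e2 : ∑ s, stateProb q s * (∑ i, Real.log (g (s i) (φ s i)) - Real.log M)
      = ∑ i, ∑ s, stateProb q s * Real.log (g (s i) (φ s i)) - Real.log M := by
    simp only [mul_sub, Finset.sum_sub_distrib]
    rw [← Finset.sum_mul, sum_stateProb, one_mul, Finset.sum_comm]
    simp only [Finset.mul_sum]
  have hlogM : Real.log M ≤ N * Rf * Real.log 2 := by
    have := Real.log_le_log hM' hc.1
    rwa [Real.log_rpow (by norm_num)] at this
  rw [sum_jointLaw_mul q φ (fun a b => Real.log (g a b)), one_div, inv_mul_le_iff₀ hN']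
  linarith

/-- No admissible code beats the single-letter optimum. If the activation probability of the code
is below `p`, its law is mixed with the rule that activates every sub-channel; the test function
built from the mixture certifies that the mixture is feasible. -/
lemma forwardRate_le {N M : ℕ} (c : FeedbackCode N M) {p q Rf C0 C1 ε0 : ℝ} (hp : 0 ≤ p ∧ p ≤ 1)
    (hq : 0 ≤ q ∧ q ≤ 1) (hC0 : 0 ≤ C0) (hC : C0 < C1) (hc : c.Admissible p Rf)
    (hε1 : ε0 ≤ 1) (hε : ε0 ∈ lowerBounds {x : ℝ | ∃ ε1 : ℝ, Feasible p q Rf x ε1}) :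
    c.forwardRate q C0 C1 ≤ q * (1 - ε0) * (C1 - C0) + p * C0 := by
  rcases Nat.eq_zero_or_pos N with rfl | hN
  · rw [forwardRate_eq_jointLaw]
    simp only [jointLaw, Nat.cast_zero, div_zero, zero_mul, add_zero]
    have h1 := mul_nonneg (mul_nonneg hq.1 (sub_nonneg.2 hε1)) (sub_nonneg.2 hC.le)
    have h2 := mul_nonneg hp.1 hC0
    linarith
  rw [forwardRate_eq_jointLaw]
  set φ : (Fin N → Bool) → (Fin N → Bool) := fun s => c.decode (c.encode s) with hφ
  set A := jointLaw q φ with hA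
  have hA0 : ∀ a b, 0 ≤ A a b := jointLaw_nonneg hq.1 hq.2 φ
  have hrow : ∀ a, A a true + A a false = bern q a := by
    intro a
    rw [← sum_jointLaw_right q hN φ a, Fintype.sum_bool]
  have hcol : A true true + A false true ≤ p :=
    jointLaw_true_add_le q p hq.1 hq.2 φ fun s => hc.2 _
  -- The conditional activation probabilities; the value at a state of weight `0` is irrelevant.
  set V : Bool → ℝ := fun a => A a true / bern q a with hV
  have hVA : ∀ a, bern q a * V a = A a true := by
    intro a
    simp only [hV]
    rcases eq_or_ne (bern q a) 0 with h | h
    · have := hrow a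
      rw [h, zero_mul]
      linarith [hA0 a true, hA0 a false]
    · field_simp
  have hV0 : ∀ a, 0 ≤ V a := fun a => div_nonneg (hA0 _ _) (bern_nonneg hq.1 hq.2 a)
  have hV1 : ∀ a, V a ≤ 1 := fun a =>
    div_le_one_of_le₀ (by linarith [hrow a, hA0 a false]) (bern_nonneg hq.1 hq.2 a)
  have hAV : ∀ a b, A a b = bern q a * bern (V a) b := by
    intro a b
    cases b
    · have := hrow a
      simp only [bern, Bool.false_eq_true, if_false] at hVA this ⊢
      rw [mul_sub, hVA]
      linarith
    · simp only [bern, if_true] at hVA ⊢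
      exact (hVA a).symm
  obtain ⟨t, ht0, ht1, ht⟩ : ∃ t : ℝ, 0 ≤ t ∧ t ≤ 1 ∧
      (1 - t) * (A true true + A false true) + t = p := by
    set p' := A true true + A false true with hp'
    rcases eq_or_lt_of_le (hcol.trans hp.2) with h | h
    · exact ⟨0, le_rfl, zero_le_one, by linarith [hp.2]⟩
    · have h' : 0 < 1 - p' := by linarith
      refine ⟨(p - p') / (1 - p'), div_nonneg (by linarith) h'.le,
        (div_le_one h').2 (by linarith [hp.2]), ?_⟩
      field_simp
      ring
  set W : Bool → ℝ := fun a => (1 - t) * V a + t with hW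
  have hW0 : ∀ a, 0 ≤ W a := fun a => by
    have := mul_nonneg (sub_nonneg.2 ht1) (hV0 a)
    simp only [hW]; linarith
  have hW1 : ∀ a, W a ≤ 1 := fun a => by
    have := mul_nonneg (sub_nonneg.2 ht1) (sub_nonneg.2 (hV1 a))
    simp only [hW]; linarith
  have hbW : ∀ a b, bern (W a) b = (1 - t) * bern (V a) b + t * bern 1 b := by
    intro a b
    cases b <;> simp only [bern, hW, if_true, Bool.false_eq_true, if_false] <;> ring
  have hqW : q * W true + (1 - q) * W false = p := by
    have h1 := hVA true
    have h2 := hVA false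
    simp only [bern, if_true, Bool.false_eq_true, if_false] at h1 h2
    rw [← ht, ← h1, ← h2]
    simp only [hW]
    ring
  have hmarg : ∀ b, ∑ a, bern q a * bern (W a) b = bern p b := by
    intro b
    cases b
    · simp only [bern, Fintype.sum_bool, ← hqW, if_true, Bool.false_eq_true, if_false]
      ring
    · simp only [bern, Fintype.sum_bool, ← hqW, if_true, Bool.false_eq_true, if_false]
  have hbW0 : ∀ a b, 0 ≤ bern (W a) b := fun a b => bern_nonneg (hW0 a) (hW1 a) b
  have hac : ∀ a b, bern q a * bern (W a) b ≠ 0 → 0 < bern p b := by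
    intro a b hab
    rw [← hmarg b]
    have hnn : ∀ a, 0 ≤ bern q a * bern (W a) b := fun a =>
      mul_nonneg (bern_nonneg hq.1 hq.2 a) (hbW0 a b)
    exact Finset.sum_pos' (fun a _ => hnn a) ⟨a, Finset.mem_univ _, (hnn a).lt_of_ne' hab⟩
  set g : Bool → Bool → ℝ := fun a b => bern (W a) b / bern p b with hg
  have hg0 : ∀ a b, 0 ≤ g a b := fun a b => div_nonneg (hbW0 a b) (bern_nonneg hp.1 hp.2 b)
  have hg1 : ∀ b, ∑ a, bern q a * g a b ≤ 1 := by
    intro b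
    have : ∑ a, bern q a * g a b = bern p b / bern p b := by
      rw [← hmarg b, Finset.sum_div]
      refine Finset.sum_congr rfl fun a _ => ?_
      simp only [hg, hmarg]
      ring
    rw [this]
    exact div_self_le_one _
  -- `g` is positive wherever the mixture has positive weight.
  have hgpos : ∀ a b, bern q a * bern (W a) b ≠ 0 → 0 < g a b := fun a b hab =>
    div_pos ((hbW0 a b).lt_of_ne' (right_ne_zero_of_mul hab)) (hac a b hab)
  have htest : (1 - t) * ∑ a, ∑ b, A a b * Real.log (g a b) ≤ Rf * Real.log 2 * (1 - t) := by
    rcases eq_or_lt_of_le ht1 with rfl | ht1'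
    · simp
    · rw [mul_comm]
      refine mul_le_mul_of_nonneg_right ?_ (sub_nonneg.2 ht1)
      refine sum_jointLaw_mul_log_le c hq.1 hq.2 hN hc g hg0 hg1 fun a b hab => hgpos a b ?_
      have hab' : 0 < bern q a * bern (V a) b := by rw [← hAV]; exact hab
      have h1 : 0 < bern (V a) b := pos_of_mul_pos_right hab' (bern_nonneg hq.1 hq.2 a)
      have h2 : 0 < bern (W a) b := by
        rw [hbW]
        have := mul_pos (sub_pos.2 ht1') h1
        have := mul_nonneg ht0 (bern_nonneg zero_le_one le_rfl b)
        linarith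
      exact mul_ne_zero (left_ne_zero_of_mul hab'.ne') h2.ne'
  have hall : t * ∑ a, bern q a * Real.log (g a true) ≤ 0 := by
    rcases eq_or_lt_of_le ht0 with rfl | ht0'
    · simp
    · refine mul_nonpos_of_nonneg_of_nonpos ht0 ?_
      have h1 : ∀ a, bern q a * Real.log (g a true) ≤ bern q a * g a true - bern q a := by
        intro a
        rcases (bern_nonneg hq.1 hq.2 a).eq_or_lt with h | h
        · simp [← h]
        · have hWa : bern (W a) true ≠ 0 := by
            have := mul_nonneg (sub_nonneg.2 ht1) (hV0 a)
            simp only [bern, if_true, hW]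
            positivity
          have := Real.log_le_sub_one_of_pos (hgpos a true (mul_ne_zero h.ne' hWa))
          nlinarith
      refine (Finset.sum_le_sum fun a _ => h1 a).trans ?_
      rw [Finset.sum_sub_distrib, sum_bern]
      linarith [hg1 true]
  have hinfo : info q p W ≤ Rf * Real.log 2 := by
    have e : info q p W = (1 - t) * ∑ a, ∑ b, A a b * Real.log (g a b)
        + t * ∑ a, bern q a * Real.log (g a true) := by
      simp only [info, hbW, hAV, Fintype.sum_bool, hg]
      simp only [bern, if_true, Bool.false_eq_true, if_false]
      ring
    have hRf : 0 ≤ Rf * Real.log 2 := by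
      have := sum_jointLaw_mul_log_le c hq.1 hq.2 hN hc (fun _ _ => 1) (fun _ _ => zero_le_one)
        (fun b => by simp only [mul_one, sum_bern, le_refl]) (fun _ _ _ => zero_lt_one)
      simpa using this
    nlinarith [mul_nonneg hRf ht0]
  have hfeas : Feasible p q Rf (1 - W true) (W false) := by
    refine ⟨?_, by linarith, by linarith [hW1 true], by linarith [hW0 true], hW0 _, hW1 _⟩
    rw [info_eq q p W (fun a b hab => (hac a b hab).ne'), hqW] at hinfo
    have hl : 0 < Real.log 2 := Real.log_pos (by norm_num)
    have hb : Real.binEntropy p = -(p * Real.log p) - (1 - p) * Real.log (1 - p) := by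
      simp [Real.binEntropy, Real.log_inv]
      ring
    have e : H2 p - q * H2 (1 - W true) - (1 - q) * H2 (W false)
        = (Real.binEntropy p - q * Real.binEntropy (W true)
          - (1 - q) * Real.binEntropy (W false)) / Real.log 2 := by
      simp only [H2, Real.binEntropy_one_sub]
      ring
    rw [e, div_le_iff₀ hl, hb]
    linarith
  have hle : ε0 ≤ 1 - W true := hε ⟨_, hfeas⟩
  have h1 : A true true ≤ q * (1 - ε0) := by
    have h := hVA true
    simp only [bern, if_true] at h
    rw [← h]
    refine mul_le_mul_of_nonneg_left ?_ hq.1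
    have : V true ≤ W true := by
      simp only [hW]
      nlinarith [hV1 true]
    linarith
  nlinarith [mul_le_mul_of_nonneg_right h1 (sub_nonneg.2 hC.le),
    mul_le_mul_of_nonneg_right hcol hC0]

/-! ### Achievability -/

lemma Achievable.mono {p q Rf C0 C1 r r' : ℝ} (h : Achievable p q Rf C0 C1 r) (hr : r' ≤ r) :
    Achievable p q Rf C0 C1 r' := fun δ hδ =>
  (h δ hδ).mono fun _ ⟨x, hx, hle⟩ => ⟨x, hx, by linarith⟩

lemma dataRate_nonneg {C0 C1 : ℝ} (hC0 : 0 ≤ C0) (hC : C0 < C1) {N : ℕ} (s v : Fin N → Bool) :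
    0 ≤ dataRate C0 C1 s v := by
  refine mul_nonneg (by positivity) (Finset.sum_nonneg fun i _ => ?_)
  split_ifs <;> linarith

/-- Without feedback, activating the same `⌊p N⌋` sub-channels in every block is asymptotically
as good as activating each sub-channel with probability `p`, independently of its state. -/
lemma achievable_const {p q Rf C0 C1 : ℝ} (hp : 0 ≤ p ∧ p ≤ 1) (hq : 0 ≤ q ∧ q ≤ 1)
    (hRf : 0 ≤ Rf) (hC0 : 0 ≤ C0) (hC : C0 < C1) :
    Achievable p q Rf C0 C1 (p * (q * C1 + (1 - q) * C0)) := by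
  intro δ hδ
  set D := q * C1 + (1 - q) * C0 with hD
  have hD0 : 0 ≤ D := add_nonneg (mul_nonneg hq.1 (by linarith))
    (mul_nonneg (sub_nonneg.2 hq.2) hC0)
  have hlim : Tendsto (fun N : ℕ => D / (N : ℝ)) atTop (𝓝 0) :=
    tendsto_const_div_atTop_nhds_zero_nat D
  filter_upwards [hlim.eventually (gt_mem_nhds hδ), eventually_gt_atTop 0] with N hN hN0
  have hN' : (0 : ℝ) < N := by exact_mod_cast hN0
  set k := ⌊p * N⌋₊ with hk
  have hkp : (k : ℝ) ≤ p * N := Nat.floor_le (mul_nonneg hp.1 hN'.le)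
  have hkN : k ≤ N := by
    have : (k : ℝ) ≤ N := hkp.trans (mul_le_of_le_one_left hN'.le hp.2)
    exact_mod_cast this
  set v : Fin N → Bool := fun i => decide (i.val < k) with hv
  have hw : normWeight v = k / N := by
    simp only [normWeight, hv, decide_eq_true_eq, Finset.sum_boole, Fin.card_filter_val_lt,
      min_eq_right hkN]
    ring
  refine ⟨_, ⟨1, ⟨fun _ => 0, fun _ => v⟩, ⟨?_, fun _ => ?_⟩, rfl⟩, ?_⟩
  · exact_mod_cast Real.one_le_rpow one_le_two (mul_nonneg hN'.le hRf)
  · rw [hw, div_le_iff₀ hN']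
    exact hkp
  · have hrate : ∑ s : Fin N → Bool, stateProb q s * dataRate C0 C1 s v = normWeight v * D := by
      have e : ∀ i : Fin N, ∑ s : Fin N → Bool, stateProb q s *
          (if v i = true then (if s i = true then C1 else C0) else 0)
          = (if v i = true then (1 : ℝ) else 0) * D := by
        intro i
        split_ifs with h
        · rw [sum_stateProb_mul_apply q i (fun a => if a = true then C1 else C0)]
          simp [bern, hD]
        · simp
      calc _ = ∑ s : Fin N → Bool, ∑ i, (1 / (N : ℝ)) * (stateProb q s *
          (if v i = true then (if s i = true then C1 else C0) else 0)) := by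
            refine Finset.sum_congr rfl fun s _ => ?_
            rw [dataRate, ← Finset.mul_sum, ← Finset.mul_sum]
            ring
        _ = _ := by
            rw [Finset.sum_comm]
            simp only [← Finset.mul_sum, e]
            rw [← Finset.sum_mul, normWeight]
            ring
    simp only [FeedbackCode.forwardRate]
    rw [hrate, hw]
    have h1 : p * N < k + 1 := Nat.lt_floor_add_one _
    have h2 : p - 1 / N ≤ k / N := by
      rw [sub_le_iff_le_add, ← add_div, le_div_iff₀ hN']
      exact h1.le
    have h3 := mul_le_mul_of_nonneg_right h2 hD0
    have h4 : 1 / (N : ℝ) * D = D / N := by ring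
    linarith [sub_mul p (1 / (N : ℝ)) D]

open Classical in
/-- Covering lemma. Let `T` be a relation of good pairs of a state vector and a power loading
vector, on which the density of the channel `W` with respect to the Bernoulli law with parameter
`p` is at most `exp (N J)`. The states from which `W` leads to a good pair with probability at
least `1 / 2` are covered greedily by `M` codewords; all others have probability at most twice
the probability of the pairs that are not good. -/
lemma exists_covering_code {p q Rf C0 C1 r J : ℝ} {N M : ℕ} {W : Bool → ℝ}
    (hp : 0 ≤ p ∧ p ≤ 1) (hq : 0 ≤ q ∧ q ≤ 1) (hC0 : 0 ≤ C0) (hC : C0 < C1)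
    (hW : ∀ a, 0 ≤ W a ∧ W a ≤ 1) (hJ : 0 ≤ J) (hM : 0 < M)
    (hMR : (M : ℝ) ≤ (2 : ℝ) ^ ((N : ℝ) * Rf)) (T : (Fin N → Bool) → (Fin N → Bool) → Prop)
    (hTw : ∀ s v, T s v → normWeight v ≤ p) (hTr : ∀ s v, T s v → r ≤ dataRate C0 C1 s v)
    (hTi : ∀ s v, T s v →
      ∏ i, bern (W (s i)) (v i) ≤ Real.exp (N * J) * ∏ i, bern p (v i)) :
    ∃ r' ∈ forwardRates p q Rf C0 C1 N,
      r - |r| * ((1 - Real.exp (-(N * J)) / 2) ^ M + 2 * ∑ s : Fin N → Bool, ∑ v : Fin N → Bool,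
        (if T s v then 0 else ∏ i, (bern q (s i) * bern (W (s i)) (v i)))) ≤ r' := by
  set Wn : (Fin N → Bool) → (Fin N → Bool) → ℝ := fun s v => ∏ i, bern (W (s i)) (v i) with hWn
  set Q : (Fin N → Bool) → ℝ := fun v => ∏ i, bern p (v i) with hQ
  have hWn0 : ∀ s v, 0 ≤ Wn s v := fun s v =>
    Finset.prod_nonneg fun i _ => bern_nonneg (hW _).1 (hW _).2 _
  have hWn1 : ∀ s, ∑ v, Wn s v = 1 := by
    intro s
    simp only [hWn]
    rw [← Fintype.prod_sum (fun i b => bern (W (s i)) b)]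
    simp only [sum_bern, Finset.prod_const_one]
  have hP0 : ∀ s : Fin N → Bool, 0 ≤ stateProb q s := stateProb_nonneg hq.1 hq.2
  set G : (Fin N → Bool) → Prop := fun s => 1 / 2 ≤ ∑ v, if T s v then Wn s v else 0 with hG
  set P₀ : (Fin N → Bool) → ℝ := fun s => if G s then stateProb q s else 0 with hP₀
  have hy0 : 0 < Real.exp (-(N * J)) := Real.exp_pos _
  have hy1 : Real.exp (-(N * J)) ≤ 1 :=
    Real.exp_le_one_iff.2 (neg_nonpos.2 (mul_nonneg (Nat.cast_nonneg _) hJ))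
  obtain ⟨c, hc⟩ := exists_codebook P₀ Q
    (fun s => by simp only [hP₀]; split_ifs; exacts [hP0 s, le_rfl])
    (fun v => Finset.prod_nonneg fun i _ => bern_nonneg hp.1 hp.2 _)
    (sum_stateProb p N) T (Real.exp (-(N * J)) / 2) (by linarith)
    (by
      intro s hs
      have hGs : G s := by
        by_contra h
        simp [hP₀, h] at hs
      calc Real.exp (-(N * J)) / 2 ≤ Real.exp (-(N * J)) * ∑ v, (if T s v then Wn s v else 0) := by
            have := mul_le_mul_of_nonneg_left hGs hy0.le
            linarith
        _ ≤ _ := by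
            rw [Finset.mul_sum]
            refine Finset.sum_le_sum fun v _ => ?_
            split_ifs with h
            · have := mul_le_mul_of_nonneg_left (hTi s v h) hy0.le
              rwa [← mul_assoc, ← Real.exp_add, neg_add_cancel, Real.exp_zero, one_mul] at this
            · simp) M
  -- States outside `G` reach a pair that is not good with probability at least `1 / 2`.
  have hbad : ∀ s, stateProb q s - P₀ s
      ≤ 2 * ∑ v, (if T s v then 0 else stateProb q s * Wn s v) := by
    intro s
    have e : ∑ v, (if T s v then 0 else stateProb q s * Wn s v)
        = stateProb q s * (1 - ∑ v, if T s v then Wn s v else 0) := by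
      rw [← hWn1 s, ← Finset.sum_sub_distrib, Finset.mul_sum]
      refine Finset.sum_congr rfl fun v _ => ?_
      split_ifs <;> ring
    by_cases h : G s
    · simp only [hP₀, h, if_true, sub_self]
      refine mul_nonneg zero_le_two (Finset.sum_nonneg fun v _ => ?_)
      split_ifs
      exacts [le_rfl, mul_nonneg (hP0 s) (hWn0 s v)]
    · rw [e]
      simp only [hP₀, h, if_false]
      have h' : ∑ v, (if T s v then Wn s v else 0) < 1 / 2 := not_le.1 h
      nlinarith [hP0 s]
  have hP₀1 : ∑ s, P₀ s ≤ 1 := by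
    rw [← sum_stateProb q N]
    refine Finset.sum_le_sum fun s _ => ?_
    simp only [hP₀]
    split_ifs
    exacts [le_rfl, hP0 s]
  have hunc : ∑ s, (if ∃ m, T s (c m) then 0 else stateProb q s)
      ≤ (1 - Real.exp (-(N * J)) / 2) ^ M + 2 * ∑ s : Fin N → Bool, ∑ v : Fin N → Bool,
        (if T s v then 0 else ∏ i, (bern q (s i) * bern (W (s i)) (v i))) := by
    have hpow : 0 ≤ (1 - Real.exp (-(N * J)) / 2) ^ M := pow_nonneg (by linarith) _
    calc _ ≤ ∑ s, ((if ∃ m, T s (c m) then 0 else P₀ s)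
          + 2 * ∑ v, (if T s v then 0 else stateProb q s * Wn s v)) := by
          refine Finset.sum_le_sum fun s _ => ?_
          split_ifs with h
          · rw [zero_add]
            refine mul_nonneg zero_le_two (Finset.sum_nonneg fun v _ => ?_)
            split_ifs
            exacts [le_rfl, mul_nonneg (hP0 s) (hWn0 s v)]
          · linarith [hbad s]
      _ ≤ (1 - Real.exp (-(N * J)) / 2) ^ M * 1
          + 2 * ∑ s, ∑ v, (if T s v then 0 else stateProb q s * Wn s v) := by
          rw [Finset.sum_add_distrib, ← Finset.mul_sum]
          have := mul_le_mul_of_nonneg_left hP₀1 hpow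
          linarith
      _ = _ := by
          simp only [mul_one, hWn, Finset.prod_mul_distrib, stateProb_eq_prod_bern]
  -- A codeword that activates too many sub-channels is in no good pair, so it may be replaced by
  -- the zero vector.
  let code : FeedbackCode N M :=
    { encode := fun s => if h : ∃ m, T s (c m) then h.choose else ⟨0, hM⟩
      decode := fun m => if normWeight (c m) ≤ p then c m else fun _ => false }
  refine ⟨_, ⟨M, code, ⟨hMR, fun m => ?_⟩, rfl⟩, ?_⟩
  · simp only [code]
    split_ifs with h
    · exact h
    · simpa [normWeight] using hp.1
  · have hrate : ∀ s, r - |r| * (if ∃ m, T s (c m) then 0 else 1)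
        ≤ dataRate C0 C1 s (code.decode (code.encode s)) := by
      intro s
      by_cases h : ∃ m, T s (c m)
      · have hs := h.choose_spec
        have e : code.decode (code.encode s) = c h.choose := by
          simp only [code, h, dite_true]
          exact if_pos (hTw _ _ hs)
        rw [e]
        simpa [h] using hTr _ _ hs
      · simp only [h, if_false, mul_one]
        linarith [dataRate_nonneg hC0 hC s (code.decode (code.encode s)), le_abs_self r]
    calc _ ≤ r - |r| * ∑ s, (if ∃ m, T s (c m) then 0 else stateProb q s) := by
          have := mul_le_mul_of_nonneg_left hunc (abs_nonneg r)
          linarith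
      _ = ∑ s, stateProb q s * (r - |r| * (if ∃ m, T s (c m) then 0 else 1)) := by
          simp only [mul_sub, Finset.sum_sub_distrib]
          rw [← Finset.sum_mul, sum_stateProb, one_mul, Finset.mul_sum]
          congr 1
          refine Finset.sum_congr rfl fun s _ => ?_
          split_ifs <;> ring
      _ ≤ _ := Finset.sum_le_sum fun s _ => mul_le_mul_of_nonneg_left (hrate s) (hP0 s)

/-- A test channel `W` with information below the feedback rate and activation probability below
`p` is simulated by codes. -/
lemma eventually_exists_code {p q Rf C0 C1 r δ : ℝ} {W : Bool → ℝ} (hp0 : 0 < p) (hp1 : p < 1)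
    (hq : 0 ≤ q ∧ q ≤ 1) (hRf : 0 < Rf) (hC0 : 0 ≤ C0) (hC : C0 < C1)
    (hW : ∀ a, 0 ≤ W a ∧ W a ≤ 1) (hmean : q * W true + (1 - q) * W false < p)
    (hinfo : info q p W < Rf * Real.log 2)
    (hr : r < q * W true * C1 + (1 - q) * W false * C0) (hδ : 0 < δ) :
    ∀ᶠ N : ℕ in atTop, ∃ r' ∈ forwardRates p q Rf C0 C1 N, r - δ ≤ r' := by
  classical
  have hl : 0 < Real.log 2 := Real.log_pos (by norm_num)
  obtain ⟨J, hJ1, hJ2⟩ := exists_between (max_lt hinfo (mul_pos hRf hl))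
  have hJi : info q p W < J := (le_max_left _ _).trans_lt hJ1
  have hJ0 : 0 < J := (le_max_right _ _).trans_lt hJ1
  set w : Bool → Bool → ℝ := fun a b => bern q a * bern (W a) b with hw
  have hbW : ∀ a b, 0 ≤ bern (W a) b := fun a b => bern_nonneg (hW a).1 (hW a).2 b
  have hbp : ∀ b, 0 < bern p b := by
    intro b
    cases b <;> simp [bern, hp0, hp1]
  have hw0 : ∀ a b, 0 ≤ w a b := fun a b => mul_nonneg (bern_nonneg hq.1 hq.2 a) (hbW a b)
  have hw1 : ∑ a, ∑ b, w a b = 1 := by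
    simp only [hw, ← Finset.mul_sum, sum_bern, mul_one]
  -- The three ways in which a pair of sequences can fail to be typical.
  set h₁ : Bool → Bool → ℝ := fun a b => Real.log (bern (W a) b / bern p b) - J with hh₁
  set h₂ : Bool → Bool → ℝ := fun _ b => (if b = true then 1 else 0) - p with hh₂
  set h₃ : Bool → Bool → ℝ := fun a b =>
    r - (if b = true then (if a = true then C1 else C0) else 0) with hh₃
  obtain ⟨ρ₁, hρ₁, hρ₁', hb₁⟩ := exists_pow_bound_of_mean_neg_prod w h₁ hw0 hw1 (by
    have e : ∑ a, ∑ b, w a b * h₁ a b = info q p W - J * ∑ a, ∑ b, w a b := by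
      simp only [info, hw, hh₁, Fintype.sum_bool]
      ring
    rw [e, hw1]
    linarith)
  obtain ⟨ρ₂, hρ₂, hρ₂', hb₂⟩ := exists_pow_bound_of_mean_neg_prod w h₂ hw0 hw1 (by
    simp [hw, hh₂, bern]
    linarith)
  obtain ⟨ρ₃, hρ₃, hρ₃', hb₃⟩ := exists_pow_bound_of_mean_neg_prod w h₃ hw0 hw1 (by
    simp [hw, hh₃, bern]
    linarith)
  set ρ₄ := Real.exp (-((Rf * Real.log 2 - J) / 4)) with hρ₄
  have hρ₄' : ρ₄ < 1 := by
    rw [hρ₄, Real.exp_lt_one_iff]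
    linarith
  have hlim : Tendsto (fun N : ℕ => |r| * (ρ₄ ^ N + 2 * (ρ₁ ^ N + ρ₂ ^ N + ρ₃ ^ N)))
      atTop (𝓝 0) := by
    have := ((tendsto_pow_atTop_nhds_zero_of_lt_one (Real.exp_pos _).le hρ₄').add
      ((((tendsto_pow_atTop_nhds_zero_of_lt_one hρ₁ hρ₁').add
        (tendsto_pow_atTop_nhds_zero_of_lt_one hρ₂ hρ₂')).add
        (tendsto_pow_atTop_nhds_zero_of_lt_one hρ₃ hρ₃')).const_mul 2)).const_mul |r|
    simpa using this
  filter_upwards [hlim.eventually (gt_mem_nhds hδ), eventually_gt_atTop 0] with N hN hN0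
  have hN' : (0 : ℝ) < N := by exact_mod_cast hN0
  have hone : (1 : ℝ) ≤ (2 : ℝ) ^ ((N : ℝ) * Rf) :=
    Real.one_le_rpow one_le_two (mul_nonneg hN'.le hRf.le)
  set M := ⌊(2 : ℝ) ^ ((N : ℝ) * Rf)⌋₊ with hM
  have hM0 : 0 < M := Nat.floor_pos.2 hone
  have hMle : (M : ℝ) ≤ (2 : ℝ) ^ ((N : ℝ) * Rf) := Nat.floor_le (by linarith)
  have hMge : (2 : ℝ) ^ ((N : ℝ) * Rf) / 2 ≤ M := by
    have h1 : (2 : ℝ) ^ ((N : ℝ) * Rf) < M + 1 := Nat.lt_floor_add_one _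
    have h2 : (1 : ℝ) ≤ M := by exact_mod_cast hM0
    linarith
  obtain ⟨T, hT⟩ : ∃ T : (Fin N → Bool) → (Fin N → Bool) → Prop, ∀ s v, T s v ↔
      ∑ i, h₁ (s i) (v i) < 0 ∧ ∑ i, h₂ (s i) (v i) < 0 ∧ ∑ i, h₃ (s i) (v i) < 0 :=
    ⟨_, fun _ _ => Iff.rfl⟩
  obtain ⟨r', hr', hle⟩ := exists_covering_code (p := p) (q := q) (Rf := Rf) (C0 := C0)
    (C1 := C1) (r := r) (J := J) (N := N) (M := M) (W := W) ⟨hp0.le, hp1.le⟩ hq hC0 hC hW hJ0.le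
    hM0 hMle T
    (by
      intro s v hTsv
      have h := ((hT s v).1 hTsv).2.1
      simp only [hh₂, Finset.sum_sub_distrib, Finset.sum_const, Finset.card_univ,
        Fintype.card_fin, nsmul_eq_mul] at h
      rw [normWeight, one_div, inv_mul_le_iff₀ hN']
      linarith)
    (by
      intro s v hTsv
      have h := ((hT s v).1 hTsv).2.2
      simp only [hh₃, Finset.sum_sub_distrib, Finset.sum_const, Finset.card_univ,
        Fintype.card_fin, nsmul_eq_mul] at h
      rw [dataRate, one_div, le_inv_mul_iff₀ hN']
      linarith)
    (by
      intro s v hTsv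
      have h := ((hT s v).1 hTsv).1
      have hQ : 0 < ∏ i, bern p (v i) := Finset.prod_pos fun i _ => hbp _
      by_cases h0 : ∃ i, bern (W (s i)) (v i) = 0
      · obtain ⟨i, hi⟩ := h0
        rw [Finset.prod_eq_zero (Finset.mem_univ i) hi]
        positivity
      · push Not at h0
        have hpos : ∀ i, 0 < bern (W (s i)) (v i) / bern p (v i) := fun i =>
          div_pos ((hbW _ _).lt_of_ne' (h0 i)) (hbp _)
        simp only [hh₁, Finset.sum_sub_distrib, Finset.sum_const, Finset.card_univ,
          Fintype.card_fin, nsmul_eq_mul] at h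
        rw [← Real.log_prod (fun i _ => (hpos i).ne'), sub_neg,
          Real.log_lt_iff_lt_exp (Finset.prod_pos fun i _ => hpos i), Finset.prod_div_distrib,
          div_lt_iff₀ hQ] at h
        exact h.le)
  refine ⟨r', hr', le_trans ?_ hle⟩
  have hA : (1 - Real.exp (-(N * J)) / 2) ^ M ≤ ρ₄ ^ N := by
    have hy1 : Real.exp (-(N * J)) ≤ 1 :=
      Real.exp_le_one_iff.2 (neg_nonpos.2 (mul_nonneg hN'.le hJ0.le))
    calc (1 - Real.exp (-(N * J)) / 2) ^ M
        ≤ Real.exp (-(Real.exp (-(N * J)) / 2)) ^ M :=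
          pow_le_pow_left₀ (by linarith) (Real.one_sub_le_exp_neg _) _
      _ = Real.exp (-(M * (Real.exp (-(N * J)) / 2))) := by
          rw [← Real.exp_nat_mul]
          ring_nf
      _ ≤ Real.exp (N * (-((Rf * Real.log 2 - J) / 4))) := by
          refine Real.exp_le_exp.2 ?_
          have h1 : (2 : ℝ) ^ ((N : ℝ) * Rf) / 2 * (Real.exp (-(N * J)) / 2)
              ≤ M * (Real.exp (-(N * J)) / 2) :=
            mul_le_mul_of_nonneg_right hMge (by positivity)
          have h2 : (2 : ℝ) ^ ((N : ℝ) * Rf) * Real.exp (-(N * J))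
              = Real.exp (N * (Rf * Real.log 2 - J)) := by
            rw [Real.rpow_def_of_pos two_pos, ← Real.exp_add]
            ring_nf
          have h3 := Real.add_one_le_exp (N * (Rf * Real.log 2 - J))
          linarith
      _ = ρ₄ ^ N := by rw [hρ₄, ← Real.exp_nat_mul]
  have hB : ∑ s : Fin N → Bool, ∑ v : Fin N → Bool,
      (if T s v then 0 else ∏ i, (bern q (s i) * bern (W (s i)) (v i))) ≤ ρ₁ ^ N + ρ₂ ^ N + ρ₃ ^ N := by
    refine le_trans ?_ (add_le_add (add_le_add (hb₁ N) (hb₂ N)) (hb₃ N))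
    simp only [← Finset.sum_add_distrib]
    refine Finset.sum_le_sum fun s _ => Finset.sum_le_sum fun v _ => ?_
    have hp : 0 ≤ ∏ i, w (s i) (v i) := Finset.prod_nonneg fun i _ => hw0 _ _
    change (if _ then 0 else ∏ i, w (s i) (v i)) ≤ _
    simp only [hT, ← not_lt]
    by_cases c1 : ∑ i, h₁ (s i) (v i) < 0 <;> by_cases c2 : ∑ i, h₂ (s i) (v i) < 0 <;>
      by_cases c3 : ∑ i, h₃ (s i) (v i) < 0 <;> simp only [c1, c2, c3, and_self, and_true,
        and_false, not_true, not_false_iff, if_true, if_false] <;> linarith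
  have := mul_le_mul_of_nonneg_left (add_le_add hA (mul_le_mul_of_nonneg_left hB zero_le_two))
    (abs_nonneg r)
  linarith

lemma info_eq_of_mem_Ioo {q p : ℝ} (hp0 : 0 < p) (hp1 : p < 1) (W : Bool → ℝ) :
    info q p W = -(q * Real.binEntropy (W true)) - (1 - q) * Real.binEntropy (W false)
      - (q * W true + (1 - q) * W false) * Real.log p
      - (1 - (q * W true + (1 - q) * W false)) * Real.log (1 - p) :=
  info_eq q p W fun _ b _ => by
    cases b <;> simp only [bern, if_true, Bool.false_eq_true, if_false]
    exacts [(sub_pos.2 hp1).ne', hp0.ne']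

/-- In the nondegenerate range every feasible test channel can be approached: mixing it with a
state-independent activation of probability slightly below `p` makes both the power and the
information constraint strict, since the information functional is convex. -/
lemma achievable_of_feasible {p q Rf C0 C1 ε0 ε1 : ℝ} (hp0 : 0 < p) (hp1 : p < 1)
    (hq : 0 ≤ q ∧ q ≤ 1) (hRf : 0 < Rf) (hC0 : 0 ≤ C0) (hC : C0 < C1)
    (hf : Feasible p q Rf ε0 ε1) :
    Achievable p q Rf C0 C1 (q * (1 - ε0) * (C1 - C0) + p * C0) := by
  obtain ⟨hR, hpe, h00, h01, h10, h11⟩ := hf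
  have hl : 0 < Real.log 2 := Real.log_pos (by norm_num)
  have hbp : Real.binEntropy p = -(p * Real.log p) - (1 - p) * Real.log (1 - p) := by
    simp [Real.binEntropy, Real.log_inv]
    ring
  have hR' : Real.binEntropy p - q * Real.binEntropy (1 - ε0) - (1 - q) * Real.binEntropy ε1
      ≤ Rf * Real.log 2 := by
    have e : H2 p - q * H2 ε0 - (1 - q) * H2 ε1
        = (Real.binEntropy p - q * Real.binEntropy ε0
          - (1 - q) * Real.binEntropy ε1) / Real.log 2 := by
      simp only [H2]
      ring
    rwa [e, div_le_iff₀ hl, ← Real.binEntropy_one_sub ε0] at hR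
  -- The divergence of the Bernoulli laws with parameters `x` and `p` vanishes at `x = p`.
  obtain ⟨x, hx0, hxp, hx⟩ : ∃ x, 0 < x ∧ x < p ∧
      -Real.binEntropy x - x * Real.log p - (1 - x) * Real.log (1 - p) < Rf * Real.log 2 := by
    have hcont : Continuous fun x : ℝ =>
        -Real.binEntropy x - x * Real.log p - (1 - x) * Real.log (1 - p) := by fun_prop
    have hp : -Real.binEntropy p - p * Real.log p - (1 - p) * Real.log (1 - p)
        < Rf * Real.log 2 := by
      have := mul_pos hRf hl
      rw [hbp]
      linarith
    have hev := (hcont.tendsto p).eventually (gt_mem_nhds hp)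
    have hev' := (hev.and (lt_mem_nhds hp0)).filter_mono (nhdsWithin_le_nhds (s := Set.Iio p))
    obtain ⟨x, ⟨h1, h2⟩, h3⟩ := (hev'.and self_mem_nhdsWithin).exists
    exact ⟨x, h2, h3, h1⟩
  intro δ hδ
  set τ := q * (1 - ε0) * (C1 - C0) + p * C0 with hτ
  have hτ0 : 0 ≤ τ := add_nonneg (mul_nonneg (mul_nonneg hq.1 (by linarith)) (by linarith))
    (mul_nonneg hp0.le hC0)
  obtain ⟨t, ht0, ht1, htτ⟩ : ∃ t : ℝ, 0 < t ∧ t ≤ 1 ∧ t * τ < δ / 2 := by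
    refine ⟨(δ / 2) / (τ + δ / 2), by positivity, (div_le_one (by positivity)).2 (by linarith), ?_⟩
    rw [div_mul_eq_mul_div, div_lt_iff₀ (by positivity)]
    nlinarith
  set W : Bool → ℝ := fun a => (1 - t) * (if a = true then 1 - ε0 else ε1) + t * x with hW
  have hWt : W true = (1 - t) * (1 - ε0) + t * x := by simp [hW]
  have hWf : W false = (1 - t) * ε1 + t * x := by simp [hW]
  have hx1 : x ≤ 1 := by linarith
  have hconc : ∀ y, 0 ≤ y → y ≤ 1 → (1 - t) * Real.binEntropy y + t * Real.binEntropy x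
      ≤ Real.binEntropy ((1 - t) * y + t * x) := fun y hy0 hy1 =>
    Real.strictConcave_binEntropy.concaveOn.2 ⟨hy0, hy1⟩ ⟨hx0.le, hx1⟩ (sub_nonneg.2 ht1) ht0.le
      (by ring)
  have hmeanW : q * W true + (1 - q) * W false = (1 - t) * p + t * x := by
    rw [hWt, hWf, ← hpe]
    ring
  have hinfo : info q p W < Rf * Real.log 2 := by
    rw [info_eq_of_mem_Ioo hp0 hp1, hmeanW]
    have h1 := mul_le_mul_of_nonneg_left (hconc (1 - ε0) (by linarith) (by linarith)) hq.1
    have h2 := mul_le_mul_of_nonneg_left (hconc ε1 h10 h11) (sub_nonneg.2 hq.2)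
    rw [← hWt] at h1
    rw [← hWf] at h2
    have h3 := mul_le_mul_of_nonneg_left hR' (sub_nonneg.2 ht1)
    have h4 := mul_lt_mul_of_pos_left hx ht0
    rw [hbp] at h3
    linarith
  have hWb : ∀ a, 0 ≤ W a ∧ W a ≤ 1 := by
    have hb : ∀ y, 0 ≤ y → y ≤ 1 → 0 ≤ (1 - t) * y + t * x ∧ (1 - t) * y + t * x ≤ 1 :=
      fun y hy0 hy1 => ⟨by nlinarith, by nlinarith⟩
    intro a
    cases a
    · rw [hWf]
      exact hb _ h10 h11
    · rw [hWt]
      exact hb _ (by linarith) (by linarith)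
  have h := eventually_exists_code (r := τ - δ / 2) (δ := δ / 2) hp0 hp1 hq hRf hC0 hC hWb
    (by rw [hmeanW]; nlinarith) hinfo (by
      have e : q * W true * C1 + (1 - q) * W false * C0
          = (1 - t) * τ + t * x * (q * (C1 - C0) + C0) := by
        have e1 : (1 - q) * W false = (1 - t) * p + t * x - q * W true := by linarith
        rw [e1, hWt, hτ]
        ring
      have : 0 ≤ t * x * (q * (C1 - C0) + C0) :=
        mul_nonneg (mul_nonneg ht0.le hx0.le)
          (add_nonneg (mul_nonneg hq.1 (by linarith)) hC0)
      rw [e]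
      linarith) (half_pos hδ)
  exact h.mono fun N ⟨r', hr', hle⟩ => ⟨r', hr', by linarith⟩

/-- In the degenerate cases feedback is useless: a sub-channel is good and activated with
probability at most `p * q`, as if state and activation were independent. For feedback rate `0`
this is the strict concavity of the entropy. -/
lemma mul_one_sub_le_of_degenerate {p q Rf ε0 ε1 : ℝ} (hp : 0 ≤ p) (hq : 0 ≤ q ∧ q ≤ 1)
    (hdeg : p ≤ 0 ∨ 1 ≤ p ∨ Rf ≤ 0) (hf : Feasible p q Rf ε0 ε1) :
    q * (1 - ε0) ≤ p * q := by
  obtain ⟨hR, hpe, h00, h01, h10, h11⟩ := hf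
  have hq1 : 0 ≤ 1 - q := sub_nonneg.2 hq.2
  rcases hdeg with h | h | h
  · nlinarith [mul_nonneg hq1 h10, mul_nonneg hp hq.1]
  · nlinarith [mul_nonneg hq.1 h00, mul_nonneg hq.1 (sub_nonneg.2 h)]
  · rcases hq.1.eq_or_lt with rfl | hq0
    · simp
    rcases hq1.eq_or_lt with hq1' | hq1'
    · have : q = 1 := by linarith
      subst this
      linarith
    rcases eq_or_ne (1 - ε0) ε1 with he | he
    · rw [← hpe, he]
      exact le_of_eq (by ring)
    · have hs := Real.strictConcave_binEntropy.2 (x := 1 - ε0) ⟨by linarith, by linarith⟩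
        (y := ε1) ⟨h10, h11⟩ he hq0 hq1' (by ring)
      simp only [smul_eq_mul, hpe, Real.binEntropy_one_sub] at hs
      have hl : 0 < Real.log 2 := Real.log_pos (by norm_num)
      have e : H2 p - q * H2 ε0 - (1 - q) * H2 ε1
          = (Real.binEntropy p - (q * Real.binEntropy ε0
            + (1 - q) * Real.binEntropy ε1)) / Real.log 2 := by
        simp only [H2]
        ring
      have := div_pos (sub_pos.2 hs) hl
      rw [e] at hR
      linarith

/-! ### The optimization problem and the optimal codes -/

lemma continuous_H2 : Continuous H2 := by
  unfold H2
  fun_prop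

lemma exists_isLeast_feasible {p q Rf : ℝ} (hp : 0 ≤ p ∧ p ≤ 1) (hRf : 0 ≤ Rf) :
    ∃ ε0 : ℝ, IsLeast {x : ℝ | ∃ ε1 : ℝ, Feasible p q Rf x ε1} ε0 := by
  set K : Set (ℝ × ℝ) := {z | Feasible p q Rf z.1 z.2} with hK
  have hH := continuous_H2
  have hsub : K = {z : ℝ × ℝ | H2 p - q * H2 z.1 - (1 - q) * H2 z.2 ≤ Rf} ∩
      {z : ℝ × ℝ | q * (1 - z.1) + (1 - q) * z.2 = p} ∩ Set.Icc 0 1 ×ˢ Set.Icc 0 1 := by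
    ext z
    simp only [hK, Feasible, Set.mem_ofPred_eq, Set.mem_inter_iff, Set.mem_prod, Set.mem_Icc]
    tauto
  have hcomp : IsCompact K := by
    rw [hsub]
    refine (isCompact_Icc.prod isCompact_Icc).inter_left (IsClosed.inter ?_ ?_)
    · exact isClosed_le (by fun_prop) continuous_const
    · exact isClosed_eq (by fun_prop) continuous_const
  have hne : K.Nonempty := by
    refine ⟨(1 - p, p), ?_, by ring, by linarith [hp.2], by linarith [hp.1], hp.1, hp.2⟩
    simp only [H2, Real.binEntropy_one_sub]
    linarith
  obtain ⟨ε0, h⟩ := (hcomp.image continuous_fst).exists_isLeast (hne.image _)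
  refine ⟨ε0, ?_, ?_⟩
  · obtain ⟨z, hz, rfl⟩ := h.1
    exact ⟨z.2, hz⟩
  · rintro x ⟨ε1, hx⟩
    exact h.2 ⟨(x, ε1), hx, rfl⟩

lemma forwardRates_nonempty {p q Rf C0 C1 : ℝ} (hp : 0 ≤ p) (hRf : 0 ≤ Rf) (N : ℕ) :
    (forwardRates p q Rf C0 C1 N).Nonempty := by
  refine ⟨_, 1, ⟨fun _ => 0, fun _ _ => false⟩, ⟨?_, fun _ => ?_⟩, rfl⟩
  · exact_mod_cast Real.one_le_rpow one_le_two (mul_nonneg (Nat.cast_nonneg _) hRf)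
  · simpa [normWeight] using hp

/-- The rate of a code depends only on the composition of its two maps, of which there are
finitely many. -/
lemma forwardRates_finite (p q Rf C0 C1 : ℝ) (N : ℕ) : (forwardRates p q Rf C0 C1 N).Finite := by
  refine (Set.finite_range fun φ : (Fin N → Bool) → (Fin N → Bool) =>
    ∑ s, stateProb q s * dataRate C0 C1 s (φ s)).subset ?_
  rintro _ ⟨M, c, -, rfl⟩
  exact ⟨fun s => c.decode (c.encode s), rfl⟩

theorem proposition1 (p q Rf C0 C1 : ℝ) (hp : 0 ≤ p ∧ p ≤ 1) (hq : 0 ≤ q ∧ q ≤ 1)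
    (hRf : 0 ≤ Rf) (hC0 : 0 ≤ C0) (hC : C0 < C1) :
    ∃ ε0 : ℝ, IsLeast {x : ℝ | ∃ ε1 : ℝ, Feasible p q Rf x ε1} ε0 ∧
      IsGreatest {r : ℝ | Achievable p q Rf C0 C1 r} (q * (1 - ε0) * (C1 - C0) + p * C0) ∧
      ∃ Cmax : ℕ → ℝ, (∀ N : ℕ, IsGreatest (forwardRates p q Rf C0 C1 N) (Cmax N)) ∧
        Tendsto Cmax atTop (𝓝 (q * (1 - ε0) * (C1 - C0) + p * C0)) := by
  obtain ⟨ε0, hleast⟩ := exists_isLeast_feasible (q := q) hp hRf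
  obtain ⟨⟨ε1, hf⟩, hlow⟩ := hleast
  have hup : ∀ N, ∀ r ∈ forwardRates p q Rf C0 C1 N,
      r ≤ q * (1 - ε0) * (C1 - C0) + p * C0 := by
    rintro N _ ⟨M, c, hc, rfl⟩
    exact forwardRate_le c hp hq hC0 hC hc hf.2.2.2.1 hlow
  have hach : Achievable p q Rf C0 C1 (q * (1 - ε0) * (C1 - C0) + p * C0) := by
    by_cases hdeg : p ≤ 0 ∨ 1 ≤ p ∨ Rf ≤ 0
    · refine (achievable_const hp hq hRf hC0 hC).mono ?_
      have := mul_le_mul_of_nonneg_right (mul_one_sub_le_of_degenerate hp.1 hq hdeg hf)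
        (sub_nonneg.2 hC.le)
      linarith
    · push Not at hdeg
      exact achievable_of_feasible hdeg.1 hdeg.2.1 hq hdeg.2.2 hC0 hC hf
  have hmax : ∀ N, ∃ r, IsGreatest (forwardRates p q Rf C0 C1 N) r := fun N =>
    (forwardRates_finite p q Rf C0 C1 N).isCompact.exists_isGreatest
      (forwardRates_nonempty hp.1 hRf N)
  choose Cmax hCmax using hmax
  refine ⟨ε0, ⟨⟨ε1, hf⟩, hlow⟩, ⟨hach, fun r hr => ?_⟩, Cmax, hCmax, ?_⟩
  · refine le_of_forall_pos_le_add fun δ hδ => ?_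
    obtain ⟨N, r', hr', hle⟩ := (hr δ hδ).exists
    linarith [hup N r' hr']
  · rw [Metric.tendsto_nhds]
    intro δ hδ
    filter_upwards [hach (δ / 2) (half_pos hδ)] with N ⟨r', hr', hle⟩
    have h1 := (hCmax N).2 hr'
    have h2 := hup N _ (hCmax N).1
    rw [Real.dist_eq, abs_lt]
    constructor <;> linarith
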